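/- Let $G$ be a finite undirected graph with vertex set $V$, internal edges $E_{\rm int}$ (each joining two vertices) and $n$ external edges $E_{\rm ext}$ (each attached to a single vertex). Let $a\ge 1$ be the dimension of every external edge, $b_e\ge 1$ the bond dimension of the internal edge $e$, and $d_k\ge1$ the logical dimension at the vertex $k$. The tensor at $k$ is a vector in the Hilbert space $\mathcal H_k$ that is the tensor product of $\mathbb C^{a}$ for each external edge at $k$, $\mathbb C^{b_e}$ for each end at $k$ of an internal edge $e$, and $\mathbb C^{d_k}$; let $$q_k=\dim\mathcal H_k=a^{\#\{\text{external edges at }k\}}\;d_k\prod_{\text{ends at }k\text{ of internal edges }e} b_e .$$ For unit vectors $|0\rangle_k\in\mathcal H_k$ and independent Haar-random unitaries $U_k$ on $\mathcal H_k$, put $|\psi_k\rangle=U_k|0\rangle_k$. For a unit vector $|\Phi\rangle\in\bigotimes_{k\in V}\mathbb C^{d_k}$ let $$|\psi\rangle=\langle\Phi|\bigotimes_{e\in E_{\rm int}}\langle\chi_e|\bigotimes_{k\in V}|\psi_k\rangle\in(\mathbb C^a)^{\otimes n}$$ be the random tensor network state, where $|\chi_e\rangle=\sum_{i=1}^{b_e}|i\,i\rangle$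 is the (unnormalized) EPR vector on the two ends of $e$. Let $|\phi\rangle\in(\mathbb C^a)^{\otimes n}$ be a unit vector and define $$\frac1{D_{\rm eff}}=a^n\,\frac{\mathbb E\big[|\langle\psi|\phi\rangle|^4\big]}{\big(\mathbb E[\langle\psi|\psi\rangle]\big)^2}.$$ For $J:E_{\rm int}\to\mathbb R$ let $$Z_J=\frac1N\sum_{\sigma\in\{-1,1\}^V}\exp\Big(\sum_{e=\langle i,j\rangle\in E_{\rm int}}J_e\sigma_i\sigma_j\Big),\qquad N=\exp\Big(\sum_{e\in E_{\rm int}}J_e\Big),$$ and let $Z_{\log\sqrt b}$ denote $Z_J$ with $J_e=\log\sqrt{b_e}$. Then both expectations are finite, $\mathbb E[\langle\psi|\psi\rangle]>0$, and $$\frac1{D_{\rm eff}}\le\frac{Z_{\log\sqrt b}}{a^n}\prod_{k\in V}\frac1{1+\frac1{q_k}},$$ with equality if $|\Phi\rangle$ is a product vector over the vertices and $|\phi\rangle$ is a product vector over the external edges. Moreover $Z_{\log\sqrt b}=\sum_{\sigma\in\{-1,1\}^V}\prod_{e=\langle i,j\rangle\in E_{\rm int}}w_e(\sigma)$ with $w_e(\sigma)=1$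 if $\sigma_i=\sigma_j$ and $w_e(\sigma)=1/b_e$ if $\sigma_i\ne\sigma_j$. -/

import Mathlib

open MeasureTheory

noncomputable section

namespace RTN

/-! ### Haar measure on the unitary group -/

section Haar

variable {ι : Type*} [Fintype ι] [DecidableEq ι]

/-- The unitary group carries its Borel sigma-algebra. -/
instance instMeasurableSpaceUnitary : MeasurableSpace (Matrix.unitaryGroup ι ℂ) := borel _

instance instBorelSpaceUnitary : BorelSpace (Matrix.unitaryGroup ι ℂ) := ⟨rfl⟩

instance instCompactSpaceUnitary : CompactSpace (Matrix.unitaryGroup ι ℂ) := by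
  have hc : IsClosed (Matrix.unitaryGroup ι ℂ : Set (Matrix ι ι ℂ)) := by
    have : (Matrix.unitaryGroup ι ℂ : Set (Matrix ι ι ℂ)) = {A | A * star A = 1} := by
      ext A
      exact Matrix.mem_unitaryGroup_iff
    rw [this]
    exact isClosed_eq (by fun_prop) continuous_const
  have hK : IsCompact (Set.univ.pi fun _ : ι => Set.univ.pi fun _ : ι =>
      Metric.closedBall (0 : ℂ) 1) :=
    isCompact_univ_pi fun _ => isCompact_univ_pi fun _ => isCompact_closedBall _ _
  rw [← isCompact_univ_iff, Subtype.isCompact_iff]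
  refine IsCompact.of_isClosed_subset (X := Matrix ι ι ℂ) hK (by simpa using hc) ?_
  rintro _ ⟨U, -, rfl⟩
  intro i _ j _
  simpa using entry_norm_bound_of_unitary U.2 i j

/-- The normalized Haar measure on the unitary group `U(ι)`: the left-invariant Borel measure
that gives the (compact) group total mass one. -/
def haarUnitary (ι : Type*) [Fintype ι] [DecidableEq ι] : Measure (Matrix.unitaryGroup ι ℂ) :=
  Measure.haarMeasure ⊤

end Haar

/-- A vector of `⨂ᵢ ℂ^(ι i)`, written in the product basis, is a product (non-entangled)
vector; the scalar `c` only matters when there are no tensor factors. -/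
def IsProductVector {S : Type*} [Fintype S] {ι : S → Type*} (φ : EuclideanSpace ℂ (∀ s, ι s)) :
    Prop :=
  ∃ (c : ℂ) (f : ∀ s, EuclideanSpace ℂ (ι s)), ∀ x, φ x = c * ∏ s, f s (x s)

/-- A finite undirected graph with vertices `V`, internal edges `E` and external edges `B`, together
with the dimensions of a tensor network on it. The two ends of an internal edge are labelled by
`Bool` (in no particular order, nothing depends on it); parallel edges and loops are allowed. An
external edge is attached to a single vertex. Every vertex has one logical leg. -/
structure Network (V E B : Type*) where
  /-- the two endpoints of an internal edge -/
  ends : E → Bool → V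
  /-- the vertex to which an external edge is attached -/
  site : B → V
  /-- the dimension of each physical (external) leg -/
  a : ℕ
  /-- the bond dimension of each internal edge -/
  b : E → ℕ
  /-- the logical dimension at each vertex -/
  d : V → ℕ
  a_pos : 0 < a
  b_pos : ∀ e, 0 < b e
  d_pos : ∀ v, 0 < d v

namespace Network

variable {V E B : Type*} [Fintype V] [DecidableEq V] [Fintype E] [DecidableEq E]
  [Fintype B] [DecidableEq B]

/-- The internal legs of the tensor at `v`: the ends of internal edges that lie at `v`. -/
abbrev IntLeg (N : Network V E B) (v : V) : Type _ := {h : E × Bool // N.ends h.1 h.2 = v}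

/-- The physical legs of the tensor at `v`. -/
abbrev ExtLeg (N : Network V E B) (v : V) : Type _ := {x : B // N.site x = v}

/-- The basis labels of the Hilbert space of the tensor at `v`: one index for each internal leg, one
for each physical leg and one for the logical leg. -/
abbrev TensorIdx (N : Network V E B) (v : V) : Type _ :=
  (∀ h : N.IntLeg v, Fin (N.b h.1.1)) × (N.ExtLeg v → Fin N.a) × Fin (N.d v)

/-- The bulk Hilbert space `⨂ᵥ ℂ^(d v)`. -/
abbrev Bulk (N : Network V E B) : Type _ := EuclideanSpace ℂ (∀ v, Fin (N.d v))

/-- The boundary Hilbert space `(ℂ^a)^{⊗ n}`. -/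
abbrev Bdy (N : Network V E B) : Type _ := EuclideanSpace ℂ (B → Fin N.a)

/-- The total dimension `q_v` of the tensor at `v`. -/
def q (N : Network V E B) (v : V) : ℕ :=
  N.a ^ Fintype.card (N.ExtLeg v) * N.d v * ∏ h : N.IntLeg v, N.b h.1.1

/-- The coefficients of the (unnormalized) EPR vector `∑ᵢ |i i⟩`. -/
def epr {m : ℕ} (i j : Fin m) : ℂ := if i = j then 1 else 0

/-- The tensor network state vector: the tensors `T v` are multiplied, and all their internal legs are
contracted with the EPR vectors of the internal edges, all their logical legs with the bra of
the bulk vector `Φ`. -/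
def state (N : Network V E B) (Φ : N.Bulk) (T : ∀ v, EuclideanSpace ℂ (N.TensorIdx v)) : N.Bdy :=
  WithLp.toLp 2 fun x => ∑ s : ∀ v, Fin (N.d v), ∑ i : ∀ h : E × Bool, Fin (N.b h.1),
    star (Φ s) * (∏ e : E, epr (i (e, false)) (i (e, true))) *
      ∏ v : V, T v (fun h => i h.1, fun y => x y.1, s v)

/-- A choice of a unitary on the Hilbert space of every tensor. -/
abbrev Unitaries (N : Network V E B) : Type _ := ∀ v, Matrix.unitaryGroup (N.TensorIdx v) ℂ

/-- The law of independent Haar-random unitaries. -/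
def law (N : Network V E B) : Measure N.Unitaries :=
  Measure.pi fun v => haarUnitary (N.TensorIdx v)

/-- The random tensor network state, with the tensor `U v |0⟩` at each vertex `v`. -/
def randomState (N : Network V E B) (Φ : N.Bulk) (ref : ∀ v, EuclideanSpace ℂ (N.TensorIdx v))
    (U : N.Unitaries) : N.Bdy :=
  N.state Φ fun v => WithLp.toLp 2 (Matrix.mulVec (U v : Matrix _ _ ℂ) (ref v).ofLp)

/-- The inverse effective dimension `a^n E|⟨ψ|φ⟩|⁴ / (E⟨ψ|ψ⟩)²`. -/
def invEffDim (N : Network V E B) (Φ : N.Bulk) (ref : ∀ v, EuclideanSpace ℂ (N.TensorIdx v))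
    (φ : N.Bdy) : ℝ :=
  (N.a : ℝ) ^ Fintype.card B * (∫ U, ‖inner ℂ (N.randomState Φ ref U) φ‖ ^ 4 ∂N.law) /
    (∫ U, ‖N.randomState Φ ref U‖ ^ 2 ∂N.law) ^ 2

/-- The Ising partition function with couplings `J` on the graph of internal edges, rescaled by
the contribution of the configuration of equal spins. Spins take values in `ℤˣ = {1, -1}`. -/
def isingZ (N : Network V E B) (J : E → ℝ) : ℝ :=
  (1 / Real.exp (∑ e, J e)) * ∑ σ : V → ℤˣ,
    Real.exp (∑ e, J e * ((σ (N.ends e false) : ℤ) : ℝ) * ((σ (N.ends e true) : ℤ) : ℝ))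

end Network

end RTN

end

open MeasureTheory

set_option linter.unusedSectionVars false

namespace RTN

/-! ### Moments of order two and four of a Haar-random vector. -/

section HaarMoments

variable {ι : Type*} [Fintype ι] [DecidableEq ι]

/-! The conjugate of `⟨ψ|φ⟩` is linear in every vertex tensor: it is the contraction of independent
Haar vectors with a fixed tensor `kernel`, the product of the conjugates of `φ` and `Φ` and of the
EPR coefficients. Averaging two copies of it and of its conjugate needs only the fourth moments of
one Haar vector in dimension `q`, and these are (identity + swap) / (q(q+1)) (`moment_eq`). Choosing
identity or swap at each vertex is choosing an Ising spin, so `E|⟨ψ|φ⟩|⁴` is a sum over spin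
configurations of `crossOverlap σ kernel` (`integral_contraction_fourth`).

Each leg inherits the spin of its vertex, hence this overlap splits into one factor each for `φ`,
`Φ` and the edges (`crossOverlap_kernel`). An edge gives `b²` when its ends agree and `b` when they
differ, which is the Ising weight up to `b²` (`crossOverlap_eprProd`, `isingZ_log_sqrt`). The
factors of `φ` and `Φ` are purities of reduced states: at most 1 for unit vectors
(`norm_crossOverlap_le`), and equal to 1 for product vectors (`crossOverlap_of_factorizes`). That is
the bound and its saturation. Second moments give the denominator, and `q² / (q(q+1)) = 1 / (1 +
1/q)` gives the product over vertices.

The fourth moments are found by hand: phase changes kill the unpaired ones, one plane reflection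
ties the remaining ones together, and normalization fixes the scale. -/

instance instIsProbabilityMeasureHaarUnitary : IsProbabilityMeasure (haarUnitary ι) :=
  ⟨by
    have h := Measure.haarMeasure_self
      (K₀ := (⊤ : TopologicalSpace.PositiveCompacts (Matrix.unitaryGroup ι ℂ)))
    simpa [haarUnitary] using h⟩

instance instIsMulLeftInvariantHaarUnitary : (haarUnitary ι).IsMulLeftInvariant := by
  unfold haarUnitary; infer_instance

/-- The image of the reference vector `r` under the unitary `U`. -/
def orbit (r : ι → ℂ) (U : Matrix.unitaryGroup ι ℂ) : ι → ℂ :=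
  Matrix.mulVec (U : Matrix ι ι ℂ) r

lemma orbit_mul (r : ι → ℂ) (W U : Matrix.unitaryGroup ι ℂ) :
    orbit r (W * U) = Matrix.mulVec (W : Matrix ι ι ℂ) (orbit r U) := by
  simp [orbit]

lemma continuous_orbit (r : ι → ℂ) : Continuous (orbit r) := by
  unfold orbit; fun_prop

lemma continuous_orbit_apply (r : ι → ℂ) (x : ι) : Continuous fun U => orbit r U x :=
  (continuous_apply x).comp (continuous_orbit r)

lemma integrable_haarUnitary {f : Matrix.unitaryGroup ι ℂ → ℂ} (hf : Continuous f) :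
    Integrable f (haarUnitary ι) :=
  hf.integrable_of_hasCompactSupport (HasCompactSupport.of_compactSpace f)

lemma sum_orbit_mul_star {r : ι → ℂ} (hr : ∑ x, r x * star (r x) = 1)
    (U : Matrix.unitaryGroup ι ℂ) : ∑ x, orbit r U x * star (orbit r U x) = 1 := by
  have h : orbit r U ⬝ᵥ star (orbit r U) = r ⬝ᵥ star r := by
    have hU : (star (U : Matrix ι ι ℂ)) * (U : Matrix ι ι ℂ) = 1 :=
      Matrix.mem_unitaryGroup_iff'.1 U.2
    rw [orbit, Matrix.star_mulVec, dotProduct_comm, ← Matrix.dotProduct_mulVec,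
      Matrix.mulVec_mulVec, ← Matrix.star_eq_conjTranspose, hU, Matrix.one_mulVec, dotProduct_comm]
  exact h.trans hr

/-- The fourth-order moments of the Haar-random vector `U r`. -/
noncomputable def moment (r : ι → ℂ) (x₁ x₂ y₁ y₂ : ι) : ℂ :=
  ∫ U, orbit r U x₁ * orbit r U x₂ * star (orbit r U y₁) * star (orbit r U y₂) ∂haarUnitary ι

lemma integrable_moment (r : ι → ℂ) (x₁ x₂ y₁ y₂ : ι) :
    Integrable (fun U => orbit r U x₁ * orbit r U x₂ * star (orbit r U y₁) *
      star (orbit r U y₂)) (haarUnitary ι) := by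
  have h := continuous_orbit_apply r
  exact integrable_haarUnitary
    ((((h x₁).mul (h x₂)).mul (h y₁).star).mul (h y₂).star)

/-- Left invariance of Haar measure. The relations between moments come from choosing `W` diagonal
or a reflection. -/
lemma integral_orbit_mulVec (r : ι → ℂ) (f : (ι → ℂ) → ℂ) {W : Matrix ι ι ℂ}
    (hW : W ∈ Matrix.unitaryGroup ι ℂ) :
    ∫ U, f (Matrix.mulVec W (orbit r U)) ∂haarUnitary ι = ∫ U, f (orbit r U) ∂haarUnitary ι := by
  rw [← integral_mul_left_eq_self (fun U => f (orbit r U)) ⟨W, hW⟩]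
  simp only [orbit_mul]

lemma moment_swap_left (r : ι → ℂ) (x₁ x₂ y₁ y₂ : ι) :
    moment r x₁ x₂ y₁ y₂ = moment r x₂ x₁ y₁ y₂ := by
  simp only [moment, mul_comm (orbit r _ x₁)]

lemma moment_swap_right (r : ι → ℂ) (x₁ x₂ y₁ y₂ : ι) :
    moment r x₁ x₂ y₁ y₂ = moment r x₁ x₂ y₂ y₁ := by
  unfold moment; congr 1; ext U; ring

lemma diagonal_mem_unitaryGroup {z : ι → ℂ} (hz : ∀ x, z x * star (z x) = 1) :
    Matrix.diagonal z ∈ Matrix.unitaryGroup ι ℂ := by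
  rw [Matrix.mem_unitaryGroup_iff, Matrix.star_eq_conjTranspose, Matrix.diagonal_conjTranspose,
    Matrix.diagonal_mul_diagonal, ← Matrix.diagonal_one]
  congr 1; ext x; exact hz x

/-- Invariance of the moments under a change of phase of one coordinate. -/
lemma moment_phase (r : ι → ℂ) (a x₁ x₂ y₁ y₂ : ι) :
    moment r x₁ x₂ y₁ y₂ =
      (if x₁ = a then Complex.I else 1) * (if x₂ = a then Complex.I else 1) *
        (if y₁ = a then -Complex.I else 1) * (if y₂ = a then -Complex.I else 1) *
        moment r x₁ x₂ y₁ y₂ := by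
  have hW := diagonal_mem_unitaryGroup (z := fun x : ι => if x = a then Complex.I else 1)
    (by intro x; split_ifs <;> simp)
  have h := integral_orbit_mulVec r (fun t => t x₁ * t x₂ * star (t y₁) * star (t y₂)) hW
  conv_lhs => rw [moment, ← h]
  rw [moment, ← integral_const_mul]
  congr 1; ext U
  have hs (y : ι) : star (if y = a then Complex.I else 1 : ℂ) =
      if y = a then -Complex.I else 1 := by
    split_ifs <;> simp
  simp only [Matrix.mulVec_diagonal, star_mul', hs]
  ring

/-- A phase on a coordinate left unpaired multiplies the moment by a constant other than 1. The
phase is `I` and not `-1` because the coordinate may occur twice among the `xᵢ`, and then the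
constant is the square of the phase. -/
lemma moment_eq_zero (r : ι → ℂ) {x₁ x₂ y₁ y₂ : ι} (h : ¬ (x₁ = y₁ ∧ x₂ = y₂))
    (h' : ¬ (x₁ = y₂ ∧ x₂ = y₁)) : moment r x₁ x₂ y₁ y₂ = 0 := by
  have key (c : ℂ) (hc : c ≠ 1) (hM : moment r x₁ x₂ y₁ y₂ = c * moment r x₁ x₂ y₁ y₂) :
      moment r x₁ x₂ y₁ y₂ = 0 := by
    have : (1 - c) * moment r x₁ x₂ y₁ y₂ = 0 := by linear_combination hM
    exact (mul_eq_zero.1 this).resolve_left (sub_ne_zero.2 hc.symm)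
  have hI : Complex.I ≠ 1 := fun h => by simpa using congrArg Complex.re h
  have hI' : -Complex.I ≠ 1 := fun h => by simpa using congrArg Complex.re h
  have hm : (-1 : ℂ) ≠ 1 := by norm_num
  by_cases h1 : x₁ = y₁
  · subst h1
    have h2 : x₂ ≠ y₂ := fun e => h ⟨rfl, e⟩
    refine key _ ?_ (moment_phase r x₂ x₁ x₂ x₁ y₂)
    by_cases h3 : x₁ = x₂ <;> simp [h3, h2.symm, hI]
  by_cases h2 : x₁ = y₂
  · subst h2
    have h2 : x₂ ≠ y₁ := fun e => h' ⟨rfl, e⟩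
    refine key _ ?_ (moment_phase r x₂ x₁ x₂ y₁ x₁)
    by_cases h3 : x₁ = x₂ <;> simp [h3, h2.symm, hI]
  · refine key _ ?_ (moment_phase r x₁ x₁ x₂ y₁ y₂)
    by_cases h3 : x₂ = x₁ <;> simp [h3, Ne.symm h1, Ne.symm h2, hI, hm]

/-- A reflection that acts on the coordinates `x` and `y` as a rational orthogonal matrix. -/
noncomputable def planeReflection (x y : ι) : Matrix ι ι ℂ :=
  1 - Matrix.vecMulVec (Pi.single x (1 / 5) + Pi.single y (7 / 5))
    (Pi.single x (1 / 5) + Pi.single y (7 / 5))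

/-- A Householder reflection `1 - u uᵀ` is orthogonal when `u ⬝ u = 2`; here `1/25 + 49/25 = 2`. The
triple (7, 24, 25) keeps all entries rational, with cosine and sine both nonzero. -/
lemma planeReflection_mem_unitaryGroup {x y : ι} (h : x ≠ y) :
    planeReflection x y ∈ Matrix.unitaryGroup ι ℂ := by
  set u : ι → ℂ := Pi.single x (1 / 5) + Pi.single y (7 / 5) with hu
  have hs : star u = u := by
    ext i
    simp only [hu, Pi.star_apply, Pi.add_apply, Pi.single_apply]
    split_ifs <;> simp
  have hn : u ⬝ᵥ u = 2 := by
    rw [hu]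
    simp [dotProduct_add, h, h.symm]
    norm_num
  have hstar : star (planeReflection x y) = planeReflection x y := by
    rw [planeReflection, star_sub, star_one, ← hu, Matrix.star_eq_conjTranspose,
      Matrix.conjTranspose_vecMulVec, hs]
  rw [Matrix.mem_unitaryGroup_iff, hstar, planeReflection, ← hu, mul_sub, sub_mul, sub_mul,
    Matrix.vecMulVec_mul_vecMulVec, hn]
  ext i j
  simp [Matrix.vecMulVec_apply]
  ring

lemma planeReflection_mulVec_left {x y : ι} (h : x ≠ y) (t : ι → ℂ) :
    Matrix.mulVec (planeReflection x y) t x = 24 / 25 * t x - 7 / 25 * t y := by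
  simp [planeReflection, Matrix.sub_mulVec, Matrix.vecMulVec_mulVec, h, add_dotProduct]
  ring

lemma planeReflection_mulVec_right {x y : ι} (h : x ≠ y) (t : ι → ℂ) :
    Matrix.mulVec (planeReflection x y) t y = -(24 / 25) * t y - 7 / 25 * t x := by
  simp [planeReflection, Matrix.sub_mulVec, Matrix.vecMulVec_mulVec, h.symm, add_dotProduct]
  ring

/-- The fourth moment of a real linear combination of two coordinates. -/
lemma integral_linear_combination (r : ι → ℂ) {x y : ι} (h : x ≠ y) (c s : ℝ) :
    ∫ U, (c * orbit r U x + s * orbit r U y) * (c * orbit r U x + s * orbit r U y) *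
        star (c * orbit r U x + s * orbit r U y) * star (c * orbit r U x + s * orbit r U y)
        ∂haarUnitary ι =
      c ^ 4 * moment r x x x x + s ^ 4 * moment r y y y y +
        4 * c ^ 2 * s ^ 2 * moment r x y x y := by
  have hexp (U : Matrix.unitaryGroup ι ℂ) :
      (c * orbit r U x + s * orbit r U y) * (c * orbit r U x + s * orbit r U y) *
        star (c * orbit r U x + s * orbit r U y) * star (c * orbit r U x + s * orbit r U y) =
      ∑ i : Bool × Bool × Bool × Bool, (cond i.1 (c : ℂ) s * cond i.2.1 (c : ℂ) s *
        cond i.2.2.1 (c : ℂ) s * cond i.2.2.2 (c : ℂ) s) *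
        (orbit r U (cond i.1 x y) * orbit r U (cond i.2.1 x y) *
          star (orbit r U (cond i.2.2.1 x y)) * star (orbit r U (cond i.2.2.2 x y))) := by
    simp only [Fintype.sum_prod_type, Fintype.sum_bool, cond_true, cond_false, star_add, star_mul',
      Complex.star_def, Complex.conj_ofReal]
    ring
  simp_rw [hexp]
  rw [integral_finsetSum _ fun i _ => (integrable_moment r _ _ _ _).const_mul _]
  simp only [integral_const_mul]
  change ∑ i : Bool × Bool × Bool × Bool, _ * moment r _ _ _ _ = _
  have hs := h.symm
  simp only [Fintype.sum_prod_type, Fintype.sum_bool, cond_true, cond_false]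
  -- Of the 16 monomials ten are unpaired and vanish; the four mixed paired ones coincide by
  -- symmetry.
  rw [moment_eq_zero r (x₁ := x) (x₂ := x) (y₁ := x) (y₂ := y) (by tauto) (by tauto),
    moment_eq_zero r (x₁ := x) (x₂ := x) (y₁ := y) (y₂ := x) (by tauto) (by tauto),
    moment_eq_zero r (x₁ := x) (x₂ := x) (y₁ := y) (y₂ := y) (by tauto) (by tauto),
    moment_eq_zero r (x₁ := x) (x₂ := y) (y₁ := x) (y₂ := x) (by tauto) (by tauto),
    moment_eq_zero r (x₁ := x) (x₂ := y) (y₁ := y) (y₂ := y) (by tauto) (by tauto),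
    moment_eq_zero r (x₁ := y) (x₂ := x) (y₁ := x) (y₂ := x) (by tauto) (by tauto),
    moment_eq_zero r (x₁ := y) (x₂ := x) (y₁ := y) (y₂ := y) (by tauto) (by tauto),
    moment_eq_zero r (x₁ := y) (x₂ := y) (y₁ := x) (y₂ := x) (by tauto) (by tauto),
    moment_eq_zero r (x₁ := y) (x₂ := y) (y₁ := x) (y₂ := y) (by tauto) (by tauto),
    moment_eq_zero r (x₁ := y) (x₂ := y) (y₁ := y) (y₂ := x) (by tauto) (by tauto),
    moment_swap_right r x y y x, moment_swap_left r y x x y, moment_swap_left r y x y x,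
    moment_swap_right r x y y x]
  ring

/-- With `c = 24/25` and `s = 7/25`, invariance gives two linear equations. Their difference has the
nonzero factor `1 - c⁴ + s⁴`, so the two diagonal moments agree; then `1 - c⁴ - s⁴ = 2c²s²` yields
the factor 2. -/
lemma moment_diagonal (r : ι → ℂ) {x y : ι} (h : x ≠ y) :
    moment r x x x x = 2 * moment r x y x y ∧ moment r y y y y = 2 * moment r x y x y := by
  have hW := planeReflection_mem_unitaryGroup h
  have h₁ := integral_orbit_mulVec r (fun t => t x * t x * star (t x) * star (t x)) hW
  have h₂ := integral_orbit_mulVec r (fun t => t y * t y * star (t y) * star (t y)) hW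
  have e₁ := integral_linear_combination r h (24 / 25) (-(7 / 25))
  have e₂ := integral_linear_combination r h (-(7 / 25)) (-(24 / 25))
  simp only [planeReflection_mulVec_left h] at h₁
  simp only [planeReflection_mulVec_right h] at h₂
  have r₁ (U : Matrix.unitaryGroup ι ℂ) :
      ((24 / 25 : ℝ) : ℂ) * orbit r U x + ((-(7 / 25) : ℝ) : ℂ) * orbit r U y =
        24 / 25 * orbit r U x - 7 / 25 * orbit r U y := by
    push_cast; ring
  have r₂ (U : Matrix.unitaryGroup ι ℂ) :
      ((-(7 / 25) : ℝ) : ℂ) * orbit r U x + ((-(24 / 25) : ℝ) : ℂ) * orbit r U y =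
        -(24 / 25) * orbit r U y - 7 / 25 * orbit r U x := by
    push_cast; ring
  simp only [r₁, h₁] at e₁
  simp only [r₂, h₂] at e₂
  change moment r x x x x = _ at e₁
  change moment r y y y y = _ at e₂
  push_cast at e₁ e₂
  have hxy : moment r x x x x = moment r y y y y := by
    linear_combination (25 ^ 4 / (2 * (25 ^ 4 - 24 ^ 4 + 7 ^ 4)) : ℂ) * 2 * (e₁ - e₂)
  constructor
  · linear_combination (25 ^ 4 / (2 * 24 ^ 2 * 7 ^ 2) : ℂ) * e₁ -
      (7 ^ 4 / (2 * 24 ^ 2 * 7 ^ 2) : ℂ) * hxy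
  · linear_combination (25 ^ 4 / (2 * 24 ^ 2 * 7 ^ 2) : ℂ) * e₁ -
      (7 ^ 4 / (2 * 24 ^ 2 * 7 ^ 2) : ℂ) * hxy - hxy

lemma sum_moment {r : ι → ℂ} (hr : ∑ x, r x * star (r x) = 1) :
    ∑ x, ∑ y, moment r x y x y = 1 := by
  have h : ∀ U : Matrix.unitaryGroup ι ℂ, ∑ x, ∑ y, orbit r U x * orbit r U y *
      star (orbit r U x) * star (orbit r U y) = 1 := by
    intro U
    have h := sum_orbit_mul_star hr U
    calc _ = (∑ x, orbit r U x * star (orbit r U x)) * ∑ y, orbit r U y * star (orbit r U y) := by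
          rw [Finset.sum_mul_sum]
          exact Finset.sum_congr rfl fun x _ => Finset.sum_congr rfl fun y _ => by ring
      _ = 1 := by rw [h, one_mul]
  calc ∑ x, ∑ y, moment r x y x y
      = ∫ U, ∑ x, ∑ y, orbit r U x * orbit r U y *
          star (orbit r U x) * star (orbit r U y) ∂haarUnitary ι := by
        rw [integral_finsetSum _ fun x _ =>
          integrable_finsetSum _ fun y _ => integrable_moment r x y x y]
        refine Finset.sum_congr rfl fun x _ => ?_
        rw [integral_finsetSum _ fun y _ => integrable_moment r x y x y]
        rfl
    _ = 1 := by simp only [h, integral_const, probReal_univ, one_smul]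

lemma moment_self {r : ι → ℂ} (hr : ∑ x, r x * star (r x) = 1) (x : ι) :
    moment r x x x x = 2 / (Fintype.card ι * (Fintype.card ι + 1)) := by
  -- All paired moments are expressed through the single unknown `m = moment r x x x x`; summing to
  -- 1 then reads `(n² + n) m / 2 = 1`, valid also for `n = 1`.
  have hall (y z : ι) : moment r y z y z =
      moment r x x x x / 2 + if y = z then moment r x x x x / 2 else 0 := by
    have hy : moment r y y y y = moment r x x x x := by
      by_cases e : y = x
      · rw [e]
      · rw [(moment_diagonal r e).1, (moment_diagonal r e).2]
    by_cases e : y = z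
    · subst e; simp [hy]
    · rw [if_neg e, ← hy, (moment_diagonal r e).1]; ring
  have h := sum_moment hr
  rw [Finset.sum_congr rfl fun y _ => Finset.sum_congr rfl fun z _ => hall y z] at h
  generalize moment r x x x x = m at h ⊢
  simp [Finset.sum_add_distrib] at h
  have : (Fintype.card ι : ℂ) ≠ 0 := by
    have : Nonempty ι := ⟨x⟩
    exact_mod_cast Fintype.card_ne_zero
  have : (Fintype.card ι : ℂ) + 1 ≠ 0 := by exact_mod_cast Nat.succ_ne_zero (Fintype.card ι)
  field_simp
  linear_combination 2 * h

/-- The fourth-order moments of a Haar-random unit vector: each spin `u = ±1` contributes the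
identity or the swap of the two copies. -/
theorem moment_eq {r : ι → ℂ} (hr : ∑ x, r x * star (r x) = 1) (x₁ x₂ y₁ y₂ : ι) :
    moment r x₁ x₂ y₁ y₂ = ∑ u : ℤˣ, (if y₁ = (if u = 1 then x₁ else x₂) ∧
      y₂ = (if u = 1 then x₂ else x₁) then 1 else 0) *
        (1 / (Fintype.card ι * (Fintype.card ι + 1)) : ℂ) := by
  have hsum (F : ℤˣ → ℂ) : ∑ u, F u = F 1 + F (-1) := by
    rw [show (Finset.univ : Finset ℤˣ) = {1, -1} from rfl, Finset.sum_pair (by decide)]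
  have hne : (-1 : ℤˣ) ≠ 1 := by decide
  rw [hsum]
  simp only [if_true, if_neg hne]
  have hoff {x y : ι} (h : x ≠ y) :
      moment r x y x y = 1 / (Fintype.card ι * (Fintype.card ι + 1)) := by
    have := (moment_diagonal r h).1
    rw [moment_self hr] at this
    linear_combination -(1 / 2 : ℂ) * this
  by_cases h : x₁ = y₁ ∧ x₂ = y₂
  · obtain ⟨rfl, rfl⟩ := h
    -- For equal indices both spins contribute, which accounts for the numerator 2 in `moment_self`.
    by_cases e : x₁ = x₂
    · subst e
      rw [moment_self hr]
      simp only [and_self, if_true]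
      ring
    · rw [hoff e]; simp [e]
  by_cases h' : x₁ = y₂ ∧ x₂ = y₁
  · obtain ⟨rfl, rfl⟩ := h'
    have e : x₁ ≠ x₂ := fun e => h ⟨e, e.symm⟩
    rw [moment_swap_right, hoff e]; simp [e]
  · rw [moment_eq_zero r h h', if_neg (by tauto), if_neg (by tauto)]; simp

/-- The second-order moments of a Haar-random unit vector. -/
theorem integral_orbit_mul_star {r : ι → ℂ} (hr : ∑ x, r x * star (r x) = 1) (x y : ι) :
    ∫ U, orbit r U x * star (orbit r U y) ∂haarUnitary ι =
      (if y = x then 1 else 0) * (1 / Fintype.card ι : ℂ) := by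
  -- Inserting the squared norm 1 of the vector turns second moments into sums of fourth moments.
  have h : ∀ U : Matrix.unitaryGroup ι ℂ, orbit r U x * star (orbit r U y) =
      ∑ z, orbit r U x * orbit r U z * star (orbit r U y) * star (orbit r U z) := by
    intro U
    have h := sum_orbit_mul_star hr U
    calc _ = orbit r U x * star (orbit r U y) * ∑ z, orbit r U z * star (orbit r U z) := by
          rw [h, mul_one]
      _ = _ := by
          rw [Finset.mul_sum]
          exact Finset.sum_congr rfl fun x _ => by ring
  simp_rw [h]
  rw [integral_finsetSum _ fun z _ => integrable_moment r x z y z]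
  change ∑ z, moment r x z y z = _
  have hne : (-1 : ℤˣ) ≠ 1 := by decide
  have hsum (F : ℤˣ → ℂ) : ∑ u, F u = F 1 + F (-1) := by
    rw [show (Finset.univ : Finset ℤˣ) = {1, -1} from rfl, Finset.sum_pair (by decide)]
  simp_rw [moment_eq hr, hsum, if_true, if_neg hne, and_true]
  have : (Fintype.card ι : ℂ) ≠ 0 := by
    have : Nonempty ι := ⟨x⟩
    exact_mod_cast Fintype.card_ne_zero
  have : (Fintype.card ι : ℂ) + 1 ≠ 0 := by exact_mod_cast Nat.succ_ne_zero (Fintype.card ι)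
  by_cases e : y = x
  · subst e
    simp [Finset.sum_add_distrib, eq_comm]
    field_simp
  · have h0 (z : ι) : ¬ (y = z ∧ z = x) := fun h => e (h.1.trans h.2)
    simp [e, h0]

end HaarMoments

/-! ### Partial swaps of two copies of a vector. -/

section CrossOverlap

variable {S : Type*} {κ : S → Type*}

/-- Take the entries of `g` where the spin is `1`, and those of `h` where it is `-1`. -/
def mix (σ : S → ℤˣ) (g h : ∀ s, κ s) : ∀ s, κ s := fun s => if σ s = 1 then g s else h s

lemma mix_mix (σ : S → ℤˣ) (g h : ∀ s, κ s) : mix σ (mix σ g h) (mix σ h g) = g := by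
  ext s; simp only [mix]; split_ifs <;> rfl

variable [Fintype S] [∀ s, Fintype (κ s)] [DecidableEq S]

/-- The overlap of two copies of the vector `F` with their image under the swap of those factors
where the spin is `-1`. -/
noncomputable def crossOverlap (σ : S → ℤˣ) (F : (∀ s, κ s) → ℂ) : ℂ :=
  ∑ g, ∑ h, F g * F h * star (F (mix σ g h)) * star (F (mix σ h g))

/-- The partial swap is an involution on pairs of labels, so it only reindexes the double sum. -/
lemma sum_sum_mix (σ : S → ℤˣ) (A : (∀ s, κ s) → (∀ s, κ s) → ℝ) :
    ∑ g, ∑ h, A (mix σ g h) (mix σ h g) = ∑ g, ∑ h, A g h := by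
  let τ : (∀ s, κ s) × (∀ s, κ s) → (∀ s, κ s) × (∀ s, κ s) :=
    fun p => (mix σ p.1 p.2, mix σ p.2 p.1)
  have hτ : Function.Involutive τ := fun p => Prod.ext (mix_mix _ _ _) (mix_mix _ _ _)
  have := Equiv.sum_comp hτ.toPerm fun p => A p.1 p.2
  simp only [Fintype.sum_prod_type] at this
  exact this

/-- Termwise `2uv ≤ u² + v²`, with `u` from the original pair and `v` from the swapped pair; both
squares have the same sum by `sum_sum_mix`. -/
lemma norm_crossOverlap_le (σ : S → ℤˣ) (F : (∀ s, κ s) → ℂ) :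
    ‖crossOverlap σ F‖ ≤ (∑ g, ‖F g‖ ^ 2) ^ 2 := by
  have hsq : (∑ g, ‖F g‖ ^ 2) ^ 2 = ∑ g, ∑ h, (‖F g‖ * ‖F h‖) ^ 2 := by
    rw [sq, Finset.sum_mul_sum]
    simp only [mul_pow]
  have hmix := sum_sum_mix σ fun g h => (‖F g‖ * ‖F h‖) ^ 2
  calc ‖crossOverlap σ F‖
      ≤ ∑ g, ∑ h, ‖F g * F h * star (F (mix σ g h)) * star (F (mix σ h g))‖ :=
        (norm_sum_le _ _).trans (Finset.sum_le_sum fun g _ => norm_sum_le _ _)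
    _ ≤ ∑ g, ∑ h, ((‖F g‖ * ‖F h‖) ^ 2 + (‖F (mix σ g h)‖ * ‖F (mix σ h g)‖) ^ 2) / 2 := by
        refine Finset.sum_le_sum fun g _ => Finset.sum_le_sum fun h _ => ?_
        simp only [norm_mul, norm_star]
        nlinarith [sq_nonneg (‖F g‖ * ‖F h‖ - ‖F (mix σ g h)‖ * ‖F (mix σ h g)‖)]
    _ = (∑ g, ‖F g‖ ^ 2) ^ 2 := by
        simp only [← Finset.sum_div, Finset.sum_add_distrib]
        rw [hmix, hsq]; ring

/-- A partial swap merely exchanges factors between `F g` and `F h`, leaving their product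
unchanged, so every term becomes `‖F g‖² ‖F h‖²`. -/
lemma crossOverlap_of_factorizes (σ : S → ℤˣ) (F : (∀ s, κ s) → ℂ) (c : ℂ) (f : ∀ s, κ s → ℂ)
    (hF : ∀ g, F g = c * ∏ s, f s (g s)) :
    crossOverlap σ F = (((∑ g, ‖F g‖ ^ 2) ^ 2 : ℝ) : ℂ) := by
  have hswap (g h : ∀ s, κ s) : F (mix σ g h) * F (mix σ h g) = F g * F h := by
    have : (∏ s, f s (mix σ g h s)) * ∏ s, f s (mix σ h g s) =
        (∏ s, f s (g s)) * ∏ s, f s (h s) := by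
      rw [← Finset.prod_mul_distrib, ← Finset.prod_mul_distrib]
      refine Finset.prod_congr rfl fun s _ => ?_
      simp only [mix]
      split_ifs
      · rfl
      · ring
    simp only [hF]
    linear_combination c ^ 2 * this
  have hn (z : ℂ) : z * star z = ((‖z‖ ^ 2 : ℝ) : ℂ) := by
    simpa using Complex.mul_conj' z
  rw [sq, Finset.sum_mul_sum, crossOverlap]
  push_cast
  refine Finset.sum_congr rfl fun g _ => Finset.sum_congr rfl fun h _ => ?_
  rw [mul_assoc, ← star_mul', hswap, star_mul', mul_mul_mul_comm, hn, hn]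
  push_cast; rfl

end CrossOverlap

/-! ### Averages of contractions of independent Haar vectors. -/

section Contraction

variable {V : Type*} [Fintype V] [DecidableEq V] {I : V → Type*} [∀ v, Fintype (I v)]
  [∀ v, DecidableEq (I v)]

/-- The contraction of independent random tensors with a fixed coefficient tensor `K`. -/
noncomputable def contraction (K : (∀ v, I v) → ℂ) (r : ∀ v, I v → ℂ)
    (U : ∀ v, Matrix.unitaryGroup (I v) ℂ) : ℂ :=
  ∑ g, K g * ∏ v, orbit (r v) (U v) (g v)

lemma contraction_mul_star (K : (∀ v, I v) → ℂ) (r : ∀ v, I v → ℂ)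
    (U : ∀ v, Matrix.unitaryGroup (I v) ℂ) :
    contraction K r U * star (contraction K r U) =
      ∑ g, ∑ h, K g * star (K h) *
        ∏ v, orbit (r v) (U v) (g v) * star (orbit (r v) (U v) (h v)) := by
  rw [contraction, star_sum, Finset.sum_mul_sum]
  refine Finset.sum_congr rfl fun g _ => Finset.sum_congr rfl fun h _ => ?_
  rw [star_mul', star_prod, Finset.prod_mul_distrib]
  ring

lemma integrable_contraction_term (r : ∀ v, I v → ℂ) (c : ℂ) (g h : ∀ v, I v) :
    Integrable (fun U : ∀ v, Matrix.unitaryGroup (I v) ℂ =>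
      c * ∏ v, orbit (r v) (U v) (g v) * star (orbit (r v) (U v) (h v)))
      (Measure.pi fun v => haarUnitary (I v)) :=
  (Integrable.fintype_prod_dep
    (f := fun v U => orbit (r v) U (g v) * star (orbit (r v) U (h v))) fun _ =>
      integrable_haarUnitary
        ((continuous_orbit_apply _ _).mul (continuous_orbit_apply _ _).star)).const_mul c

lemma integrable_contraction_mul_star (K : (∀ v, I v) → ℂ) (r : ∀ v, I v → ℂ) :
    Integrable (fun U => contraction K r U * star (contraction K r U))
      (Measure.pi fun v => haarUnitary (I v)) := by
  simp only [contraction_mul_star]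
  exact integrable_finsetSum _ fun g _ => integrable_finsetSum _ fun h _ =>
    integrable_contraction_term r _ g h

theorem integral_contraction_mul_star (K : (∀ v, I v) → ℂ) {r : ∀ v, I v → ℂ}
    (hr : ∀ v, ∑ x, r v x * star (r v x) = 1) :
    ∫ U, contraction K r U * star (contraction K r U) ∂(Measure.pi fun v => haarUnitary (I v)) =
      (∏ v, (1 / Fintype.card (I v) : ℂ)) * ∑ g, K g * star (K g) := by
  simp only [contraction_mul_star]
  rw [integral_finsetSum _ fun g _ => integrable_finsetSum _ fun h _ =>
    integrable_contraction_term r _ g h, Finset.mul_sum]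
  refine Finset.sum_congr rfl fun g _ => ?_
  rw [integral_finsetSum _ fun h _ => integrable_contraction_term r _ g h]
  have hterm (h : ∀ v, I v) :
      ∫ U : ∀ v, Matrix.unitaryGroup (I v) ℂ, K g * star (K h) *
        ∏ v, orbit (r v) (U v) (g v) * star (orbit (r v) (U v) (h v))
        ∂(Measure.pi fun v => haarUnitary (I v)) =
      if h = g then K g * star (K h) * ∏ v, (1 / Fintype.card (I v) : ℂ) else 0 := by
    rw [integral_const_mul, integral_fintype_prod_eq_prod
      (f := fun v U => orbit (r v) U (g v) * star (orbit (r v) U (h v)))]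
    simp only [integral_orbit_mul_star (hr _), Finset.prod_mul_distrib]
    rw [Fintype.prod_boole]
    simp only [← funext_iff]
    split_ifs <;> simp
  rw [Finset.sum_congr rfl fun h _ => hterm h, Finset.sum_ite_eq' Finset.univ g,
    if_pos (Finset.mem_univ g), mul_comm]

lemma contraction_fourth (K : (∀ v, I v) → ℂ) (r : ∀ v, I v → ℂ)
    (U : ∀ v, Matrix.unitaryGroup (I v) ℂ) :
    contraction K r U * contraction K r U * star (contraction K r U) *
        star (contraction K r U) =
      ∑ g₁, ∑ g₂, ∑ h₁, ∑ h₂, K g₁ * K g₂ * star (K h₁) * star (K h₂) *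
        ∏ v, orbit (r v) (U v) (g₁ v) * orbit (r v) (U v) (g₂ v) *
          star (orbit (r v) (U v) (h₁ v)) * star (orbit (r v) (U v) (h₂ v)) := by
  have hs : star (contraction K r U) =
      ∑ h, star (K h) * ∏ v, star (orbit (r v) (U v) (h v)) := by
    simp only [contraction, star_sum, star_mul', star_prod]
  have hprod (a b : (∀ v, I v) → ℂ) : (∑ g, a g) * (∑ g, a g) * (∑ h, b h) * (∑ h, b h) =
      ∑ g₁, ∑ g₂, ∑ h₁, ∑ h₂, a g₁ * a g₂ * b h₁ * b h₂ := by
    simp only [← Finset.mul_sum, ← Finset.sum_mul]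
  rw [hs, contraction, hprod]
  simp only [Finset.prod_mul_distrib]
  refine Finset.sum_congr rfl fun g₁ _ => Finset.sum_congr rfl fun g₂ _ =>
    Finset.sum_congr rfl fun h₁ _ => Finset.sum_congr rfl fun h₂ _ => ?_
  ring

lemma integrable_contraction_fourth_term (r : ∀ v, I v → ℂ) (c : ℂ) (g₁ g₂ h₁ h₂ : ∀ v, I v) :
    Integrable (fun U : ∀ v, Matrix.unitaryGroup (I v) ℂ =>
      c * ∏ v, orbit (r v) (U v) (g₁ v) * orbit (r v) (U v) (g₂ v) *
          star (orbit (r v) (U v) (h₁ v)) * star (orbit (r v) (U v) (h₂ v)))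
      (Measure.pi fun v => haarUnitary (I v)) :=
  (Integrable.fintype_prod_dep
    (f := fun v U => orbit (r v) U (g₁ v) * orbit (r v) U (g₂ v) * star (orbit (r v) U (h₁ v)) *
      star (orbit (r v) U (h₂ v))) fun _ => integrable_moment _ _ _ _ _).const_mul c

lemma integrable_contraction_fourth (K : (∀ v, I v) → ℂ) (r : ∀ v, I v → ℂ) :
    Integrable (fun U => contraction K r U * contraction K r U * star (contraction K r U) *
        star (contraction K r U)) (Measure.pi fun v => haarUnitary (I v)) := by
  simp only [contraction_fourth]
  exact integrable_finsetSum _ fun g₁ _ => integrable_finsetSum _ fun g₂ _ =>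
    integrable_finsetSum _ fun h₁ _ => integrable_finsetSum _ fun h₂ _ =>
    integrable_contraction_fourth_term r _ g₁ g₂ h₁ h₂

/-- The averaged fourth power of a contraction is a sum over spin configurations. -/
theorem integral_contraction_fourth (K : (∀ v, I v) → ℂ) {r : ∀ v, I v → ℂ}
    (hr : ∀ v, ∑ x, r v x * star (r v x) = 1) :
    ∫ U, contraction K r U * contraction K r U * star (contraction K r U) *
        star (contraction K r U) ∂(Measure.pi fun v => haarUnitary (I v)) =
      (∏ v, (1 / (Fintype.card (I v) * (Fintype.card (I v) + 1)) : ℂ)) *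
        ∑ σ : V → ℤˣ, crossOverlap σ K := by
  have hterm (g₁ g₂ h₁ h₂ : ∀ v, I v) :
      ∫ U : ∀ v, Matrix.unitaryGroup (I v) ℂ, K g₁ * K g₂ * star (K h₁) * star (K h₂) *
        ∏ v, orbit (r v) (U v) (g₁ v) * orbit (r v) (U v) (g₂ v) *
          star (orbit (r v) (U v) (h₁ v)) * star (orbit (r v) (U v) (h₂ v))
        ∂(Measure.pi fun v => haarUnitary (I v)) =
      ∑ σ : V → ℤˣ, if h₂ = mix σ g₂ g₁ then (if h₁ = mix σ g₁ g₂ then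
        K g₁ * K g₂ * star (K h₁) * star (K h₂) *
          ∏ v, (1 / (Fintype.card (I v) * (Fintype.card (I v) + 1)) : ℂ) else 0) else 0 := by
    rw [integral_const_mul, integral_fintype_prod_eq_prod
      (f := fun v U => orbit (r v) U (g₁ v) * orbit (r v) U (g₂ v) *
        star (orbit (r v) U (h₁ v)) * star (orbit (r v) U (h₂ v)))]
    change _ * ∏ v, moment (r v) (g₁ v) (g₂ v) (h₁ v) (h₂ v) = _
    simp only [moment_eq (hr _)]
    -- Expanding the product over vertices of two-term sums creates the spin configurations; the
    -- Kronecker deltas of each one force `h₁` and `h₂` to be the partial swaps of `g₁` and `g₂`.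
    rw [Fintype.prod_sum, Finset.mul_sum]
    refine Finset.sum_congr rfl fun σ _ => ?_
    rw [Finset.prod_mul_distrib, Fintype.prod_boole]
    have hiff : (∀ v, h₁ v = (if σ v = 1 then g₁ v else g₂ v) ∧
        h₂ v = if σ v = 1 then g₂ v else g₁ v) ↔ h₁ = mix σ g₁ g₂ ∧ h₂ = mix σ g₂ g₁ := by
      simp only [forall_and, funext_iff, mix]
    simp only [hiff]
    by_cases e₁ : h₁ = mix σ g₁ g₂ <;> by_cases e₂ : h₂ = mix σ g₂ g₁ <;> simp [e₁, e₂]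
  have hint := integrable_contraction_fourth_term r
  simp only [contraction_fourth]
  rw [integral_finsetSum _ fun g₁ _ => integrable_finsetSum _ fun g₂ _ =>
    integrable_finsetSum _ fun h₁ _ => integrable_finsetSum _ fun h₂ _ => hint _ g₁ g₂ h₁ h₂]
  have hsum (g₁ g₂ : ∀ v, I v) :
      ∫ U : ∀ v, Matrix.unitaryGroup (I v) ℂ, ∑ h₁, ∑ h₂, K g₁ * K g₂ * star (K h₁) * star (K h₂) *
        ∏ v, orbit (r v) (U v) (g₁ v) * orbit (r v) (U v) (g₂ v) *
          star (orbit (r v) (U v) (h₁ v)) * star (orbit (r v) (U v) (h₂ v))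
        ∂(Measure.pi fun v => haarUnitary (I v)) =
      ∑ σ : V → ℤˣ, (∏ v, (1 / (Fintype.card (I v) * (Fintype.card (I v) + 1)) : ℂ)) *
        (K g₁ * K g₂ * star (K (mix σ g₁ g₂)) * star (K (mix σ g₂ g₁))) := by
    rw [integral_finsetSum _ fun h₁ _ => integrable_finsetSum _ fun h₂ _ => hint _ g₁ g₂ h₁ h₂]
    rw [Finset.sum_congr rfl fun h₁ _ => integral_finsetSum _ fun h₂ _ => hint _ g₁ g₂ h₁ h₂]
    rw [Finset.sum_congr rfl fun h₁ _ => Finset.sum_congr rfl fun h₂ _ => hterm g₁ g₂ h₁ h₂]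
    rw [Finset.sum_congr rfl fun h₁ _ => Finset.sum_comm, Finset.sum_comm]
    refine Finset.sum_congr rfl fun σ _ => ?_
    simp only [Finset.sum_ite_eq', Finset.mem_univ, if_true]
    rw [mul_comm]
  rw [Finset.sum_congr rfl fun g₁ _ => integral_finsetSum _ fun g₂ _ =>
    integrable_finsetSum _ fun h₁ _ => integrable_finsetSum _ fun h₂ _ => hint _ g₁ g₂ h₁ h₂]
  rw [Finset.sum_congr rfl fun g₁ _ => Finset.sum_congr rfl fun g₂ _ => hsum g₁ g₂]
  rw [Finset.sum_congr rfl fun g₁ _ => Finset.sum_comm, Finset.sum_comm, Finset.mul_sum]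
  refine Finset.sum_congr rfl fun σ _ => ?_
  simp only [crossOverlap, Finset.mul_sum]

end Contraction
-- The network amplitude as a contraction, and its splitting by kinds of legs.
namespace Network

variable {V E B : Type*} [Fintype V] [DecidableEq V] [Fintype E] [DecidableEq E]
  [Fintype B] [DecidableEq B]

lemma card_tensorIdx (N : Network V E B) (v : V) : Fintype.card (N.TensorIdx v) = N.q v := by
  simp [TensorIdx, q, Fintype.card_pi]
  ring

lemma q_pos (N : Network V E B) (v : V) : 0 < N.q v :=
  Nat.mul_pos (Nat.mul_pos (pow_pos N.a_pos _) (N.d_pos v)) (Finset.prod_pos fun _ _ => N.b_pos _)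

/-- Labels of all the legs of the network. -/
abbrev Legs (N : Network V E B) : Type _ :=
  (B → Fin N.a) × (∀ v, Fin (N.d v)) × (∀ h : E × Bool, Fin (N.b h.1))

/-- Distribute the labels of all legs among the vertices. -/
def legEquiv (N : Network V E B) : N.Legs ≃ ∀ v, N.TensorIdx v where
  toFun p v := (fun h => p.2.2 h.1, fun y => p.1 y.1, p.2.1 v)
  invFun g := (fun x => (g (N.site x)).2.1 ⟨x, rfl⟩, fun v => (g v).2.2,
    fun h => (g (N.ends h.1 h.2)).1 ⟨h, rfl⟩)
  left_inv _ := rfl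
  right_inv g := by
    funext v
    refine Prod.ext ?_ (Prod.ext ?_ rfl)
    · funext ⟨h, hh⟩; subst hh; rfl
    · funext ⟨x, hx⟩; subst hx; rfl

lemma mix_legEquiv (N : Network V E B) (σ : V → ℤˣ) (p p' : N.Legs) :
    mix σ (N.legEquiv p) (N.legEquiv p') = N.legEquiv (mix (fun x => σ (N.site x)) p.1 p'.1,
      mix σ p.2.1 p'.2.1, mix (fun h => σ (N.ends h.1 h.2)) p.2.2 p'.2.2) := by
  funext v
  simp only [mix, legEquiv, Equiv.coe_fn_mk]
  refine Prod.ext ?_ (Prod.ext ?_ ?_)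
  · funext ⟨h, hh⟩; subst hh
    simp only; split_ifs <;> rfl
  · funext ⟨x, hx⟩; subst hx
    simp only; split_ifs <;> rfl
  · simp only; split_ifs <;> rfl

/-- The coefficients of the product of the EPR vectors of all internal edges. -/
def eprProd (N : Network V E B) (i : ∀ h : E × Bool, Fin (N.b h.1)) : ℂ :=
  ∏ e : E, epr (i (e, false)) (i (e, true))

/-- The coefficient tensor with which the vertex tensors are contracted in `⟨φ|ψ⟩`. -/
noncomputable def kernel (N : Network V E B) (Φ : N.Bulk) (φ : N.Bdy) (g : ∀ v, N.TensorIdx v) :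
    ℂ :=
  star (φ (N.legEquiv.symm g).1) * star (Φ (N.legEquiv.symm g).2.1) *
    N.eprProd (N.legEquiv.symm g).2.2

/-- `inner` is conjugate-linear in its first argument, so it is the conjugate that is linear in the
tensors. -/
lemma star_inner_randomState (N : Network V E B) (Φ : N.Bulk)
    (ref : ∀ v, EuclideanSpace ℂ (N.TensorIdx v)) (φ : N.Bdy) (U : N.Unitaries) :
    star (inner ℂ (N.randomState Φ ref U) φ) =
      contraction (N.kernel Φ φ) (fun v => (ref v).ofLp) U := by
  rw [contraction, ← N.legEquiv.sum_comp, Fintype.sum_prod_type]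
  simp only [Fintype.sum_prod_type, PiLp.inner_apply, star_sum, randomState, state, kernel,
    Equiv.symm_apply_apply, RCLike.inner_apply]
  refine Finset.sum_congr rfl fun x _ => ?_
  simp only [star_mul', Complex.star_def, starRingEnd_self_apply, Finset.mul_sum]
  refine Finset.sum_congr rfl fun s _ => Finset.sum_congr rfl fun i _ => ?_
  simp only [eprProd, legEquiv, Equiv.coe_fn_mk, orbit]
  ring

/-- The kernel is a product over physical, logical and internal legs, and by `mix_legEquiv` partial
swaps act on the three kinds separately. -/
lemma crossOverlap_kernel (N : Network V E B) (Φ : N.Bulk) (φ : N.Bdy) (σ : V → ℤˣ) :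
    crossOverlap σ (N.kernel Φ φ) =
      crossOverlap (fun x => σ (N.site x)) (fun x : B → Fin N.a => star (φ x)) *
      crossOverlap σ (fun s : ∀ v, Fin (N.d v) => star (Φ s)) *
      crossOverlap (fun h : E × Bool => σ (N.ends h.1 h.2)) N.eprProd := by
  have hprod (X : (B → Fin N.a) → (B → Fin N.a) → ℂ)
      (Y : (∀ v, Fin (N.d v)) → (∀ v, Fin (N.d v)) → ℂ)
      (Z : (∀ h : E × Bool, Fin (N.b h.1)) → (∀ h : E × Bool, Fin (N.b h.1)) → ℂ) :
      (∑ x, ∑ x', X x x') * (∑ s, ∑ s', Y s s') * (∑ i, ∑ i', Z i i') =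
      ∑ p : N.Legs, ∑ p' : N.Legs, X p.1 p'.1 * Y p.2.1 p'.2.1 * Z p.2.2 p'.2.2 := by
    simp only [← Fintype.sum_prod_type', Fintype.sum_mul_sum]
    refine Fintype.sum_equiv
      ⟨fun w => ((w.1.1.1, w.1.2.1, w.2.1), (w.1.1.2, w.1.2.2, w.2.2)),
        fun w => (((w.1.1, w.2.1), (w.1.2.1, w.2.2.1)), (w.1.2.2, w.2.2.2)),
        fun _ => rfl, fun _ => rfl⟩ _ _ fun _ => rfl
  unfold crossOverlap
  rw [hprod, ← N.legEquiv.sum_comp]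
  refine Finset.sum_congr rfl fun p _ => ?_
  rw [← N.legEquiv.sum_comp]
  refine Finset.sum_congr rfl fun p' _ => ?_
  simp only [mix_legEquiv, kernel, Equiv.symm_apply_apply, star_mul']
  ring

lemma sum_kernel_mul_star (N : Network V E B) (Φ : N.Bulk) (φ : N.Bdy) :
    ∑ g, N.kernel Φ φ g * star (N.kernel Φ φ g) =
      (∑ x, φ x * star (φ x)) * (∑ s, Φ s * star (Φ s)) *
        ∑ i, N.eprProd i * star (N.eprProd i) := by
  rw [← N.legEquiv.sum_comp, Fintype.sum_mul_sum, ← Fintype.sum_prod_type', Fintype.sum_mul_sum,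
    ← Fintype.sum_prod_type']
  refine Fintype.sum_equiv (Equiv.prodAssoc _ _ _).symm _ _ fun p => ?_
  simp only [kernel, Equiv.symm_apply_apply, star_mul', star_star, Equiv.prodAssoc_symm_apply]
  ring

/-! ### Edge factors and Ising weights. -/

/-- Group the labels of the ends of the internal edges by edges. -/
def edgeEquiv (N : Network V E B) :
    (∀ e, Fin (N.b e) × Fin (N.b e)) ≃ ∀ h : E × Bool, Fin (N.b h.1) where
  toFun p h := cond h.2 (p h.1).2 (p h.1).1
  invFun i e := (i (e, false), i (e, true))
  left_inv _ := rfl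
  right_inv i := by funext ⟨e, t⟩; cases t <;> rfl

lemma star_epr {m : ℕ} (i j : Fin m) : star (epr i j) = epr i j := by
  unfold epr; split_ifs <;> simp

lemma star_eprProd (N : Network V E B) (i : ∀ h : E × Bool, Fin (N.b h.1)) :
    star (N.eprProd i) = N.eprProd i := by
  simp only [eprProd, star_prod, star_epr]

lemma sum_eprProd_mul_star (N : Network V E B) :
    ∑ i, N.eprProd i * star (N.eprProd i) = ∏ e, (N.b e : ℂ) := by
  simp only [star_eprProd]
  rw [← N.edgeEquiv.sum_comp]
  simp only [eprProd, edgeEquiv, Equiv.coe_fn_mk, cond_true, cond_false, ← Finset.prod_mul_distrib]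
  rw [← Fintype.prod_sum (fun e (p : Fin (N.b e) × Fin (N.b e)) => epr p.1 p.2 * epr p.1 p.2)]
  refine Finset.prod_congr rfl fun e _ => ?_
  simp [Fintype.sum_prod_type, epr]

/-- The sum factorizes over edges. Equal spins leave two free labels on an edge, hence `b²`;
opposite spins identify all four end labels, hence `b`. -/
lemma crossOverlap_eprProd (N : Network V E B) (σ : V → ℤˣ) :
    crossOverlap (fun h : E × Bool => σ (N.ends h.1 h.2)) N.eprProd =
      ∏ e, (N.b e : ℂ) ^ 2 *
        if σ (N.ends e false) = σ (N.ends e true) then 1 else 1 / (N.b e : ℂ) := by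
  simp only [crossOverlap, star_eprProd]
  rw [← N.edgeEquiv.sum_comp]
  simp only [← N.edgeEquiv.sum_comp (fun i => _ * N.eprProd i * _ * _)]
  simp only [eprProd, edgeEquiv, Equiv.coe_fn_mk, cond_true, cond_false, mix,
    ← Finset.prod_mul_distrib]
  have hb (e : E) : (N.b e : ℂ) ≠ 0 := by exact_mod_cast (N.b_pos e).ne'
  let f (e : E) (p q : Fin (N.b e) × Fin (N.b e)) : ℂ := epr p.1 p.2 * epr q.1 q.2 *
    epr (if σ (N.ends e false) = 1 then p.1 else q.1) (if σ (N.ends e true) = 1 then p.2 else q.2) *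
    epr (if σ (N.ends e false) = 1 then q.1 else p.1) (if σ (N.ends e true) = 1 then q.2 else p.2)
  trans ∏ e, ∑ p, ∑ q, f e p q
  · simp only [Fintype.prod_sum]
    rfl
  refine Finset.prod_congr rfl fun e _ => ?_
  simp only [f]
  rcases Int.units_eq_one_or (σ (N.ends e false)) with h₁ | h₁ <;>
  rcases Int.units_eq_one_or (σ (N.ends e true)) with h₂ | h₂ <;>
  simp [h₁, h₂, Fintype.sum_prod_type, epr] <;> field_simp [hb e]


theorem isingZ_log_sqrt (N : Network V E B) :
    N.isingZ (fun e => Real.log √(N.b e : ℝ)) =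
      ∑ σ : V → ℤˣ, ∏ e, if σ (N.ends e false) = σ (N.ends e true) then 1
        else 1 / (N.b e : ℝ) := by
  rw [isingZ, Finset.mul_sum]
  refine Finset.sum_congr rfl fun σ _ => ?_
  rw [one_div, ← Real.exp_neg, ← Real.exp_add, ← Finset.sum_neg_distrib, ← Finset.sum_add_distrib,
    Real.exp_sum]
  refine Finset.prod_congr rfl fun e _ => ?_
  have hb : (0 : ℝ) < N.b e := by exact_mod_cast N.b_pos e
  -- An anti-aligned edge has exponent `-J` and the normalization contributes another `-J`, where
  -- `2J = log b`.
  have hanti : Real.exp (-Real.log √(N.b e : ℝ) + -Real.log √(N.b e : ℝ)) = (N.b e : ℝ)⁻¹ := by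
    rw [Real.log_sqrt hb.le, ← neg_add, add_halves, Real.exp_neg, Real.exp_log hb]
  rcases Int.units_eq_one_or (σ (N.ends e false)) with h₁ | h₁ <;>
  rcases Int.units_eq_one_or (σ (N.ends e true)) with h₂ | h₂ <;>
  simp [h₁, h₂, hanti, show (-1 : ℤˣ) ≠ 1 by decide, show (1 : ℤˣ) ≠ -1 by decide]

/-! ### Moments of the random tensor network state. -/

lemma sum_mul_star_eq_norm_sq {κ : Type*} [Fintype κ] (x : EuclideanSpace ℂ κ) :
    ∑ i, x i * star (x i) = ((‖x‖ ^ 2 : ℝ) : ℂ) := by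
  rw [EuclideanSpace.norm_sq_eq]
  push_cast
  exact Finset.sum_congr rfl fun i _ => Complex.mul_conj' _

lemma norm_sq_inner_randomState (N : Network V E B) (Φ : N.Bulk)
    (ref : ∀ v, EuclideanSpace ℂ (N.TensorIdx v)) (φ : N.Bdy) (U : N.Unitaries) :
    ((‖inner ℂ (N.randomState Φ ref U) φ‖ ^ 2 : ℝ) : ℂ) =
      contraction (N.kernel Φ φ) (fun v => (ref v).ofLp) U *
        star (contraction (N.kernel Φ φ) (fun v => (ref v).ofLp) U) := by
  rw [← star_inner_randomState, star_star, mul_comm]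
  push_cast
  exact (Complex.mul_conj' _).symm

lemma norm_pow_four_inner_randomState (N : Network V E B) (Φ : N.Bulk)
    (ref : ∀ v, EuclideanSpace ℂ (N.TensorIdx v)) (φ : N.Bdy) (U : N.Unitaries) :
    ((‖inner ℂ (N.randomState Φ ref U) φ‖ ^ 4 : ℝ) : ℂ) =
      contraction (N.kernel Φ φ) (fun v => (ref v).ofLp) U *
        contraction (N.kernel Φ φ) (fun v => (ref v).ofLp) U *
        star (contraction (N.kernel Φ φ) (fun v => (ref v).ofLp) U) *
        star (contraction (N.kernel Φ φ) (fun v => (ref v).ofLp) U) := by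
  rw [show (4 : ℕ) = 2 * 2 from rfl, pow_mul, Complex.ofReal_pow, norm_sq_inner_randomState]
  ring

lemma integrable_norm_sq_inner (N : Network V E B) (Φ : N.Bulk)
    (ref : ∀ v, EuclideanSpace ℂ (N.TensorIdx v)) (φ : N.Bdy) :
    Integrable (fun U => ‖inner ℂ (N.randomState Φ ref U) φ‖ ^ 2) N.law := by
  have h := integrable_contraction_mul_star (N.kernel Φ φ) (fun v => (ref v).ofLp)
  simp only [← norm_sq_inner_randomState] at h
  exact h.re

lemma integrable_norm_pow_four_inner (N : Network V E B) (Φ : N.Bulk)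
    (ref : ∀ v, EuclideanSpace ℂ (N.TensorIdx v)) (φ : N.Bdy) :
    Integrable (fun U => ‖inner ℂ (N.randomState Φ ref U) φ‖ ^ 4) N.law := by
  have h := integrable_contraction_fourth (N.kernel Φ φ) (fun v => (ref v).ofLp)
  simp only [← norm_pow_four_inner_randomState] at h
  exact h.re

/-- Reduces the norm to overlaps with basis vectors; each has the same mean square, which produces
the factor `a^n` in `integral_norm_sq_randomState`. -/
lemma norm_sq_randomState (N : Network V E B) (Φ : N.Bulk)
    (ref : ∀ v, EuclideanSpace ℂ (N.TensorIdx v)) (U : N.Unitaries) :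
    ‖N.randomState Φ ref U‖ ^ 2 =
      ∑ x, ‖inner ℂ (N.randomState Φ ref U) (EuclideanSpace.single x (1 : ℂ))‖ ^ 2 := by
  rw [EuclideanSpace.norm_sq_eq]
  simp [EuclideanSpace.inner_single_right]

theorem integral_norm_sq_inner (N : Network V E B) {Φ : N.Bulk} (hΦ : ‖Φ‖ = 1)
    {ref : ∀ v, EuclideanSpace ℂ (N.TensorIdx v)} (href : ∀ v, ‖ref v‖ = 1)
    {φ : N.Bdy} (hφ : ‖φ‖ = 1) :
    ∫ U, ‖inner ℂ (N.randomState Φ ref U) φ‖ ^ 2 ∂N.law =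
      (∏ v, 1 / (N.q v : ℝ)) * ∏ e, (N.b e : ℝ) := by
  have hr (v : V) : ∑ x, ref v x * star (ref v x) = 1 := by
    rw [sum_mul_star_eq_norm_sq, href]; simp
  have h := integral_contraction_mul_star (N.kernel Φ φ) hr
  simp only [← norm_sq_inner_randomState] at h
  rw [integral_complex_ofReal, sum_kernel_mul_star, sum_eprProd_mul_star, sum_mul_star_eq_norm_sq,
    sum_mul_star_eq_norm_sq, hΦ, hφ] at h
  simp only [card_tensorIdx] at h
  have h' : ((∫ U, ‖inner ℂ (N.randomState Φ ref U) φ‖ ^ 2 ∂N.law : ℝ) : ℂ) =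
      (((∏ v, 1 / (N.q v : ℝ)) * ∏ e, (N.b e : ℝ) : ℝ) : ℂ) := by
    refine Eq.trans h ?_
    push_cast; ring
  exact_mod_cast h'

theorem integral_norm_sq_randomState (N : Network V E B) {Φ : N.Bulk} (hΦ : ‖Φ‖ = 1)
    {ref : ∀ v, EuclideanSpace ℂ (N.TensorIdx v)} (href : ∀ v, ‖ref v‖ = 1) :
    ∫ U, ‖N.randomState Φ ref U‖ ^ 2 ∂N.law =
      (N.a : ℝ) ^ Fintype.card B * ((∏ v, 1 / (N.q v : ℝ)) * ∏ e, (N.b e : ℝ)) := by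
  simp only [norm_sq_randomState]
  rw [integral_finsetSum _ fun x _ => N.integrable_norm_sq_inner Φ ref _,
    Finset.sum_congr rfl fun x _ => N.integral_norm_sq_inner hΦ href (by simp)]
  simp

theorem integral_norm_pow_four_inner (N : Network V E B) (Φ : N.Bulk)
    {ref : ∀ v, EuclideanSpace ℂ (N.TensorIdx v)} (href : ∀ v, ‖ref v‖ = 1) (φ : N.Bdy) :
    ((∫ U, ‖inner ℂ (N.randomState Φ ref U) φ‖ ^ 4 ∂N.law : ℝ) : ℂ) =
      (∏ v, (1 / (N.q v * (N.q v + 1)) : ℂ)) * ∑ σ : V → ℤˣ,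
        crossOverlap (fun x => σ (N.site x)) (fun x : B → Fin N.a => star (φ x)) *
        crossOverlap σ (fun s : ∀ v, Fin (N.d v) => star (Φ s)) *
        ∏ e, (N.b e : ℂ) ^ 2 *
          if σ (N.ends e false) = σ (N.ends e true) then 1 else 1 / (N.b e : ℂ) := by
  have hr (v : V) : ∑ x, ref v x * star (ref v x) = 1 := by
    rw [sum_mul_star_eq_norm_sq, href]; simp
  have h := integral_contraction_fourth (N.kernel Φ φ) hr
  simp only [← norm_pow_four_inner_randomState, card_tensorIdx, crossOverlap_kernel,
    crossOverlap_eprProd] at h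
  rw [integral_complex_ofReal] at h
  exact h

lemma sum_norm_star_sq {κ : Type*} [Fintype κ] {x : EuclideanSpace ℂ κ} (hx : ‖x‖ = 1) :
    (∑ i, ‖star (x i)‖ ^ 2) ^ 2 = 1 := by
  simp only [norm_star]
  rw [← EuclideanSpace.norm_sq_eq, hx]; norm_num

lemma crossOverlap_star_of_isProductVector {S : Type*} [Fintype S] [DecidableEq S] {κ : S → Type*}
    [∀ s, Fintype (κ s)] (σ : S → ℤˣ) {φ : EuclideanSpace ℂ (∀ s, κ s)} (hφ : ‖φ‖ = 1)
    (h : IsProductVector φ) : crossOverlap σ (fun x => star (φ x)) = 1 := by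
  obtain ⟨c, f, hf⟩ := h
  rw [crossOverlap_of_factorizes σ _ (star c) (fun s i => star (f s i))
    (fun g => by rw [hf, star_mul', star_prod]), sum_norm_star_sq hφ, Complex.ofReal_one]

lemma norm_crossOverlap_star_le {S : Type*} [Fintype S] [DecidableEq S] {κ : S → Type*}
    [∀ s, Fintype (κ s)] (σ : S → ℤˣ) {φ : EuclideanSpace ℂ (∀ s, κ s)} (hφ : ‖φ‖ = 1) :
    ‖crossOverlap σ (fun x => star (φ x))‖ ≤ 1 :=
  (norm_crossOverlap_le σ _).trans (sum_norm_star_sq hφ).le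

lemma sum_prod_weights (N : Network V E B) :
    ∑ σ : V → ℤˣ, ∏ e, ((N.b e : ℝ) ^ 2 *
        if σ (N.ends e false) = σ (N.ends e true) then 1 else 1 / (N.b e : ℝ)) =
      (∏ e, (N.b e : ℝ)) ^ 2 * N.isingZ (fun e => Real.log √(N.b e : ℝ)) := by
  simp only [isingZ_log_sqrt, Finset.prod_mul_distrib, Finset.mul_sum, Finset.prod_pow]

theorem integral_norm_pow_four_inner_le (N : Network V E B) {Φ : N.Bulk} (hΦ : ‖Φ‖ = 1)
    {ref : ∀ v, EuclideanSpace ℂ (N.TensorIdx v)} (href : ∀ v, ‖ref v‖ = 1)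
    {φ : N.Bdy} (hφ : ‖φ‖ = 1) :
    ∫ U, ‖inner ℂ (N.randomState Φ ref U) φ‖ ^ 4 ∂N.law ≤
      (∏ v, 1 / ((N.q v : ℝ) * (N.q v + 1))) *
        ((∏ e, (N.b e : ℝ)) ^ 2 * N.isingZ (fun e => Real.log √(N.b e : ℝ))) := by
  -- The spin sum is complex-valued termwise, so the real integral is bounded by its absolute value
  -- and the triangle inequality is applied over `ℂ`.
  refine (le_abs_self _).trans ?_
  rw [← Real.norm_eq_abs, ← Complex.norm_real, N.integral_norm_pow_four_inner Φ href φ, ← sum_prod_weights, norm_mul,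
    norm_prod]
  have hq (v : V) : ‖(1 / (N.q v * (N.q v + 1)) : ℂ)‖ = 1 / ((N.q v : ℝ) * (N.q v + 1)) := by
    have : (1 / (N.q v * (N.q v + 1)) : ℂ) = ((1 / ((N.q v : ℝ) * (N.q v + 1)) : ℝ) : ℂ) := by
      push_cast; rfl
    rw [this, Complex.norm_real, Real.norm_of_nonneg (by positivity)]
  simp only [hq]
  refine mul_le_mul_of_nonneg_left ?_ (Finset.prod_nonneg fun v _ => by positivity)
  refine (norm_sum_le _ _).trans (Finset.sum_le_sum fun σ _ => ?_)
  have hw : ‖∏ e, ((N.b e : ℂ) ^ 2 *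
      if σ (N.ends e false) = σ (N.ends e true) then 1 else 1 / (N.b e : ℂ))‖ =
      ∏ e, ((N.b e : ℝ) ^ 2 *
        if σ (N.ends e false) = σ (N.ends e true) then 1 else 1 / (N.b e : ℝ)) := by
    rw [norm_prod]
    refine Finset.prod_congr rfl fun e _ => ?_
    split_ifs <;> simp
  rw [norm_mul, norm_mul, hw]
  refine mul_le_of_le_one_left (Finset.prod_nonneg fun e _ => ?_)
    (mul_le_one₀ (norm_crossOverlap_star_le _ hφ) (norm_nonneg _)
      (norm_crossOverlap_star_le _ hΦ))
  split_ifs <;> positivity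

theorem integral_norm_pow_four_inner_of_isProductVector (N : Network V E B) {Φ : N.Bulk}
    (hΦ : ‖Φ‖ = 1) {ref : ∀ v, EuclideanSpace ℂ (N.TensorIdx v)} (href : ∀ v, ‖ref v‖ = 1)
    {φ : N.Bdy} (hφ : ‖φ‖ = 1) (hΦp : IsProductVector Φ) (hφp : IsProductVector φ) :
    ∫ U, ‖inner ℂ (N.randomState Φ ref U) φ‖ ^ 4 ∂N.law =
      (∏ v, 1 / ((N.q v : ℝ) * (N.q v + 1))) *
        ((∏ e, (N.b e : ℝ)) ^ 2 * N.isingZ (fun e => Real.log √(N.b e : ℝ))) := by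
  have h := N.integral_norm_pow_four_inner Φ href φ
  simp only [crossOverlap_star_of_isProductVector _ hφ hφp,
    crossOverlap_star_of_isProductVector _ hΦ hΦp, one_mul] at h
  rw [← sum_prod_weights]
  apply Complex.ofReal_injective
  rw [h]
  push_cast [apply_ite Complex.ofReal]
  rfl

/-- Normalizing a fourth moment of Ising form by the square of the mean norm. -/
lemma normalized_fourth_moment (N : Network V E B) (Z : ℝ) :
    (N.a : ℝ) ^ Fintype.card B * ((∏ v, 1 / ((N.q v : ℝ) * (N.q v + 1))) *
        ((∏ e, (N.b e : ℝ)) ^ 2 * Z)) /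
      ((N.a : ℝ) ^ Fintype.card B * ((∏ v, 1 / (N.q v : ℝ)) * ∏ e, (N.b e : ℝ))) ^ 2 =
      Z / (N.a : ℝ) ^ Fintype.card B * ∏ v, 1 / (1 + 1 / (N.q v : ℝ)) := by
  have hq (v : V) : (0 : ℝ) < N.q v := by exact_mod_cast N.q_pos v
  have ha : (N.a : ℝ) ≠ 0 := by exact_mod_cast N.a_pos.ne'
  have hb : ∏ e, (N.b e : ℝ) ≠ 0 :=
    Finset.prod_ne_zero_iff.2 fun e _ => by exact_mod_cast (N.b_pos e).ne'
  have hQ : ∏ v, 1 / (N.q v : ℝ) ≠ 0 :=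
    Finset.prod_ne_zero_iff.2 fun v _ => (one_div_pos.2 (hq v)).ne'
  have hprod : ∏ v, 1 / ((N.q v : ℝ) * (N.q v + 1)) =
      (∏ v, 1 / (N.q v : ℝ)) ^ 2 * ∏ v, 1 / (1 + 1 / (N.q v : ℝ)) := by
    rw [← Finset.prod_pow, ← Finset.prod_mul_distrib]
    refine Finset.prod_congr rfl fun v _ => ?_
    have := hq v
    field_simp
  rw [hprod]
  generalize ∏ v, 1 / (N.q v : ℝ) = Q at *
  generalize ∏ v, 1 / (1 + 1 / (N.q v : ℝ)) = R at *
  field_simp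

end Network
end RTN

theorem lemma2 {V E B : Type*} [Fintype V] [DecidableEq V] [Fintype E] [DecidableEq E]
    [Fintype B] [DecidableEq B]
    (N : RTN.Network V E B)
    (Φ : N.Bulk) (hΦ : ‖Φ‖ = 1)
    (ref : ∀ v, EuclideanSpace ℂ (N.TensorIdx v)) (href : ∀ v, ‖ref v‖ = 1)
    (φ : N.Bdy) (hφ : ‖φ‖ = 1) :
    -- the expectations exist and the normalization is nonzero
    MeasureTheory.Integrable (fun U => ‖N.randomState Φ ref U‖ ^ 2) N.law ∧
    MeasureTheory.Integrable (fun U => ‖inner ℂ (N.randomState Φ ref U) φ‖ ^ 4) N.law ∧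
    0 < ∫ U, ‖N.randomState Φ ref U‖ ^ 2 ∂N.law ∧
    -- the upper bound
    N.invEffDim Φ ref φ ≤
      N.isingZ (fun e => Real.log √(N.b e : ℝ)) / (N.a : ℝ) ^ Fintype.card B *
        ∏ v, 1 / (1 + 1 / (N.q v : ℝ)) ∧
    -- saturation for product states
    (RTN.IsProductVector Φ → RTN.IsProductVector φ →
      N.invEffDim Φ ref φ =
        N.isingZ (fun e => Real.log √(N.b e : ℝ)) / (N.a : ℝ) ^ Fintype.card B *
          ∏ v, 1 / (1 + 1 / (N.q v : ℝ))) ∧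
    -- the weights 1 and 1 / b of aligned and anti-aligned spins
    N.isingZ (fun e => Real.log √(N.b e : ℝ)) =
      ∑ σ : V → ℤˣ, ∏ e, if σ (N.ends e false) = σ (N.ends e true) then 1 else 1 / (N.b e : ℝ) := by
  refine ⟨?_, N.integrable_norm_pow_four_inner Φ ref φ, ?_, ?_, ?_, N.isingZ_log_sqrt⟩
  · simp only [RTN.Network.norm_sq_randomState]
    exact integrable_finsetSum _ fun x _ => N.integrable_norm_sq_inner Φ ref _
  · rw [N.integral_norm_sq_randomState hΦ href]
    have ha : (0 : ℝ) < N.a := by exact_mod_cast N.a_pos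
    exact mul_pos (pow_pos ha _) (mul_pos
      (Finset.prod_pos fun v _ => one_div_pos.2 (by exact_mod_cast N.q_pos v))
      (Finset.prod_pos fun e _ => by exact_mod_cast N.b_pos e))
  -- Rewriting the bound backwards puts both sides over the same denominator, so only the fourth
  -- moments are compared.
  · rw [RTN.Network.invEffDim, N.integral_norm_sq_randomState hΦ href,
      ← N.normalized_fourth_moment]
    gcongr
    exact N.integral_norm_pow_four_inner_le hΦ href hφ
  · intro hΦp hφp
    rw [RTN.Network.invEffDim, N.integral_norm_sq_randomState hΦ href,
      ← N.normalized_fourth_moment,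
      N.integral_norm_pow_four_inner_of_isProductVector hΦ href hφ hΦp hφp]
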